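/- All topological groups are Hausdorff. A topological group $G$ is precompact if it is isomorphic, as a topological group, to a subgroup of a compact group. A unitary representation of $G$ is a homomorphism $\rho$ from $G$ to the group $U(\mathcal H)$ of unitary operators of a complex Hilbert space $\mathcal H$, continuous for the strong operator topology; it is irreducible if $\mathcal H\neq\{0\}$ and the only closed invariant subspaces are $\{0\}$ and $\mathcal H$. Let $P_\rho$ be the set of all finite sums of functions $g\mapsto(\rho(g)v,v)$ with $v\in\mathcal H$; it depends only on the unitary equivalence class $[\rho]$. Let $\widehat G$ be the set of unitary equivalence classes of irreducible unitary representations of $G$, equipped with the Fell topology, in which a base of neighbourhoods of $[\rho]$ is given by the sets $$W(f_1,\dots,f_n,C,\varepsilon)=\{[\sigma]\in\widehat G:\ \exists\, g_1,\dots,g_n\in P_\sigma\ \ \forall x\in C\ \ \forall i\ \ |f_i(x)-g_i(x)|<\varepsilon\},$$ where $f_1,\dots,f_n\in P_\rho$, $C\subseteq G$ is compact and $\varepsilon>0$. Let $1_G\in\widehat G$ be the class of the trivial one-dimensional representation. A dense subgroup $G$ of a compact group $H$ is said to determine $H$ if $\widehat G$ is discrete. Theorem. If $G$ is a countable, non-metrizable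 precompact group, then $1_G$ is not an isolated point of $\widehat G$. In particular, if $G$ is a countable dense subgroup of a non-metrizable compact group $H$, then $G$ does not determine $H$. -/

import Mathlib

universe u

/-- A unitary representation of a topological group `G`: a homomorphism from `G` into the group of
surjective linear isometries of a complex Hilbert space, continuous for the strong operator
topology (the topology of pointwise convergence). In an irreducible representation every orbit
of a nonzero vector spans a dense subspace, so Hilbert spaces in the universe of `G` suffice. -/
structure UnitaryRep (G : Type u) [Group G] [TopologicalSpace G] where
  /-- The Hilbert space of the representation. -/
  carrier : Type u
  [normedAddCommGroup : NormedAddCommGroup carrier]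
  [innerProductSpace : InnerProductSpace ℂ carrier]
  [completeSpace : CompleteSpace carrier]
  /-- The action of `G` by unitary operators. -/
  toHom : G →* (carrier ≃ₗᵢ[ℂ] carrier)
  continuous_apply : ∀ v : carrier, Continuous fun g : G => toHom g v

attribute [instance] UnitaryRep.normedAddCommGroup UnitaryRep.innerProductSpace
  UnitaryRep.completeSpace

namespace UnitaryRep

section
variable {G : Type u} [Group G] [TopologicalSpace G]

/-- `ρ` is irreducible: its space is nonzero, and `{0}` and the whole space are the only closed
invariant subspaces. -/
def IsIrreducible (ρ : UnitaryRep G) : Prop :=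
  Nontrivial ρ.carrier ∧
    ∀ E : Submodule ℂ ρ.carrier, IsClosed (E : Set ρ.carrier) →
      (∀ g : G, ∀ v ∈ E, ρ.toHom g v ∈ E) → E = ⊥ ∨ E = ⊤

/-- Unitary equivalence: a Hilbert space isomorphism intertwines the two representations. -/
def Equivalent (ρ σ : UnitaryRep G) : Prop :=
  ∃ M : ρ.carrier ≃ₗᵢ[ℂ] σ.carrier, ∀ (g : G) (v : ρ.carrier),
    M (ρ.toHom g v) = σ.toHom g (M v)

theorem Equivalent.symm {ρ σ : UnitaryRep G} (h : Equivalent ρ σ) : Equivalent σ ρ := by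
  obtain ⟨M, hM⟩ := h
  refine ⟨M.symm, fun g v => ?_⟩
  apply M.injective
  rw [hM]
  simp

instance setoid (G : Type u) [Group G] [TopologicalSpace G] : Setoid (UnitaryRep G) where
  r := Equivalent
  iseqv :=
    { refl := fun ρ => ⟨LinearIsometryEquiv.refl ℂ ρ.carrier, fun _ _ => rfl⟩
      symm := fun h => h.symm
      trans := by
        rintro ρ σ τ ⟨M, hM⟩ ⟨N, hN⟩
        exact ⟨M.trans N, fun g v => by simp [hM, hN]⟩ }

/-- The function of positive type `g ↦ (ρ(g)v, v)` associated with `ρ` and `v`. (Mathlib's inner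
product is linear in its second argument.) -/
noncomputable def positiveTypeFunction (ρ : UnitaryRep G) (v : ρ.carrier) : G → ℂ :=
  fun g => inner ℂ v (ρ.toHom g v)

/-- The convex cone generated by the functions of positive type associated with `ρ`, that is, the
set of finite sums of such functions. -/
def positiveCone (ρ : UnitaryRep G) : Set (G → ℂ) :=
  {f | ∃ (n : ℕ) (v : Fin n → ρ.carrier), f = ∑ i, ρ.positiveTypeFunction (v i)}

theorem Equivalent.positiveCone_subset {ρ σ : UnitaryRep G} (h : Equivalent ρ σ) :
    ρ.positiveCone ⊆ σ.positiveCone := by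
  obtain ⟨M, hM⟩ := h
  rintro f ⟨n, v, rfl⟩
  refine ⟨n, fun i => M (v i), Finset.sum_congr rfl fun i _ => ?_⟩
  funext g
  simp only [positiveTypeFunction, ← hM, LinearIsometryEquiv.inner_map_map]

/-- The trivial representation, on a one-dimensional Hilbert space. -/
noncomputable def trivial (G : Type u) [Group G] [TopologicalSpace G] : UnitaryRep G where
  carrier := EuclideanSpace ℂ PUnit.{u + 1}
  toHom := 1
  continuous_apply := fun _ => continuous_const

theorem isIrreducible_of_finrank_eq_one (ρ : UnitaryRep G)
    (h : Module.finrank ℂ ρ.carrier = 1) : ρ.IsIrreducible := by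
  have h2 : IsSimpleOrder (Submodule ℂ ρ.carrier) := is_simple_module_of_finrank_eq_one h
  exact ⟨Module.nontrivial_of_finrank_eq_succ h, fun E _ _ => h2.eq_bot_or_eq_top E⟩

theorem trivial_isIrreducible (G : Type u) [Group G] [TopologicalSpace G] :
    (trivial G).IsIrreducible := by
  have h : Module.finrank ℂ (EuclideanSpace ℂ PUnit.{u + 1}) = 1 := by simp
  exact isIrreducible_of_finrank_eq_one (trivial G) h

end

end UnitaryRep

/-- The equivalence classes of unitary representations of `G`. -/
def UnitaryRepClass (G : Type u) [Group G] [TopologicalSpace G] : Type (u + 1) :=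
  Quotient (UnitaryRep.setoid G)

namespace UnitaryRepClass

section
variable {G : Type u} [Group G] [TopologicalSpace G]

/-- The cone `P_ρ`, which depends only on the equivalence class of `ρ`. -/
def positiveCone (c : UnitaryRepClass G) : Set (G → ℂ) :=
  Quotient.lift UnitaryRep.positiveCone
    (fun _ _ h => Set.Subset.antisymm (UnitaryRep.Equivalent.positiveCone_subset h)
      (UnitaryRep.Equivalent.positiveCone_subset (UnitaryRep.Equivalent.symm h))) c

/-- The basic set `W(f₁, …, fₙ, C, ε)` in a set `R` of classes, where `F = {f₁, …, fₙ}`. -/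
def basicNhd (R : Set (UnitaryRepClass G)) (F : Set (G → ℂ)) (C : Set G) (ε : ℝ) : Set R :=
  {σ | ∀ f ∈ F, ∃ g ∈ positiveCone σ.1, ∀ x ∈ C, ‖f x - g x‖ < ε}

/-- The Fell topology on a set `R` of equivalence classes of unitary representations: the sets
`W(f₁, …, fₙ, C, ε)` with `fᵢ ∈ P_ρ`, `C ⊆ G` compact and `ε > 0` form a base of neighbourhoods
of `ρ`. -/
@[reducible]
def fellTopology (R : Set (UnitaryRepClass G)) : TopologicalSpace R where
  IsOpen U := ∀ ρ ∈ U, ∃ (F : Set (G → ℂ)) (C : Set G) (ε : ℝ),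
    F.Finite ∧ F ⊆ positiveCone ρ.1 ∧ IsCompact C ∧ 0 < ε ∧ basicNhd R F C ε ⊆ U
  isOpen_univ := fun _ _ =>
    ⟨∅, ∅, 1, Set.finite_empty, Set.empty_subset _, isCompact_empty, one_pos, Set.subset_univ _⟩
  isOpen_inter := by
    rintro U V hU hV ρ ⟨hρU, hρV⟩
    obtain ⟨F, C, ε, hF, hFρ, hC, hε, hW⟩ := hU ρ hρU
    obtain ⟨F', C', ε', hF', hFρ', hC', hε', hW'⟩ := hV ρ hρV
    refine ⟨F ∪ F', C ∪ C', min ε ε', hF.union hF', Set.union_subset hFρ hFρ', hC.union hC',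
      lt_min hε hε', fun σ hσ => ⟨hW fun f hf => ?_, hW' fun f hf => ?_⟩⟩
    · obtain ⟨g, hg, h⟩ := hσ f (Or.inl hf)
      exact ⟨g, hg, fun x hx => (h x (Or.inl hx)).trans_le (min_le_left _ _)⟩
    · obtain ⟨g, hg, h⟩ := hσ f (Or.inr hf)
      exact ⟨g, hg, fun x hx => (h x (Or.inr hx)).trans_le (min_le_right _ _)⟩
  isOpen_sUnion := by
    rintro S hS ρ ⟨U, hU, hρ⟩
    obtain ⟨F, C, ε, hF, hFρ, hC, hε, hW⟩ := hS U hU ρ hρ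
    exact ⟨F, C, ε, hF, hFρ, hC, hε, hW.trans (Set.subset_sUnion_of_mem hU)⟩

end

end UnitaryRepClass

/-- The set of equivalence classes of irreducible unitary representations of `G`. -/
def irreducibleClasses (G : Type u) [Group G] [TopologicalSpace G] : Set (UnitaryRepClass G) :=
  {c | ∃ ρ : UnitaryRep G, ρ.IsIrreducible ∧ (Quotient.mk (UnitaryRep.setoid G) ρ) = c}

/-- The dual object `Ĝ` of `G`. -/
def DualObject (G : Type u) [Group G] [TopologicalSpace G] : Type (u + 1) :=
  irreducibleClasses G

namespace DualObject

/-- The dual object carries the Fell topology. -/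
instance (G : Type u) [Group G] [TopologicalSpace G] : TopologicalSpace (DualObject G) :=
  UnitaryRepClass.fellTopology (irreducibleClasses G)

/-- The class `1_G` of the trivial representation. -/
noncomputable def trivial (G : Type u) [Group G] [TopologicalSpace G] : DualObject G :=
  ⟨Quotient.mk (UnitaryRep.setoid G) (UnitaryRep.trivial G),
    UnitaryRep.trivial G, UnitaryRep.trivial_isIrreducible G, rfl⟩

end DualObject

/-- `G` is precompact: it is isomorphic, as a topological group, to a subgroup of a compact
(Hausdorff) group. The closure of the image of `G` has cardinality at most `2 ^ 2 ^ |G|`, so compact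
groups in the universe of `G` suffice. -/
def IsPrecompactGroup (G : Type u) [Group G] [TopologicalSpace G] : Prop :=
  ∃ (K : Type u) (_ : Group K) (_ : TopologicalSpace K) (_ : IsTopologicalGroup K)
    (_ : CompactSpace K) (_ : T2Space K) (φ : G →* K), Topology.IsEmbedding φ

/-- A (dense) subgroup `G` of a compact group `H` determines `H` if the dual object of `G` is
discrete. -/
def Determines {H : Type u} [Group H] [TopologicalSpace H] (G : Subgroup H) : Prop :=
  DiscreteTopology (DualObject G)

/-! If `1_G` is isolated, some compact `C` and `δ > 0` exclude nonzero `(C, δ)`-almost invariant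
vectors from every irreducible representation without invariant vectors
(`exists_isolatesTrivial_of_isOpen`). Splitting off invariant subspaces extends this to
finite-dimensional representations, with a constant depending only on the dimension
(`IsolatesTrivial.eq_zero_of_finrank`).

For matrix representations π, σ of the same degree, let G act on matrices by X ↦ σ(g) X π(g)⁻¹. If π
and σ are close on `C`, the identity matrix is almost invariant, so there is an invariant matrix
near it, that is, an invertible intertwiner (`IsolatesTrivial.exists_isUnit_intertwining`).

Since G is countable, `C` is metrizable and the matrix-valued continuous functions on it form a
separable space; so each degree has only countably many classes. By Peter–Weyl
(`exists_unitaryGroup_ne_one`) the finite-dimensional representations induce the topology of a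
precompact group, hence countably many of them do, and G is metrizable. Metrizability passes from a
dense subgroup to H, which gives the second claim. -/

namespace UnitaryRep

/-! ### Invariant subspaces and restriction -/

variable {G : Type u} [Group G] [TopologicalSpace G]

/-- The unitary representation given by a strongly continuous action by linear isometries. -/
noncomputable def ofIsometricAction {V : Type u} [NormedAddCommGroup V] [InnerProductSpace ℂ V]
    [CompleteSpace V] (f : G →* Module.End ℂ V) (hf : ∀ g v, ‖f g v‖ = ‖v‖)
    (hc : ∀ v, Continuous fun g => f g v) : UnitaryRep G where
  carrier := V
  toHom :=
    { toFun := fun g =>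
        { toLinearEquiv := LinearEquiv.ofLinearMap (f g) (f g⁻¹)
            (by rw [← Module.End.mul_eq_comp, ← map_mul, mul_inv_cancel, map_one]; rfl)
            (by rw [← Module.End.mul_eq_comp, ← map_mul, inv_mul_cancel, map_one]; rfl)
          norm_map' := hf g }
      map_one' := by ext v; change f 1 v = v; simp
      map_mul' := fun g h => by ext v; change f (g * h) v = f g (f h v); simp }
  continuous_apply := hc

theorem toHom_mul_apply (ρ : UnitaryRep G) (g h : G) (v : ρ.carrier) :
    ρ.toHom (g * h) v = ρ.toHom g (ρ.toHom h v) := by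
  rw [map_mul]; rfl

theorem toHom_one_apply (ρ : UnitaryRep G) (v : ρ.carrier) : ρ.toHom 1 v = v := by
  rw [map_one]; rfl

theorem toHom_inv_apply_self (ρ : UnitaryRep G) (g : G) (v : ρ.carrier) :
    ρ.toHom g⁻¹ (ρ.toHom g v) = v := by
  rw [← toHom_mul_apply, inv_mul_cancel, toHom_one_apply]

theorem toHom_apply_inv_self (ρ : UnitaryRep G) (g : G) (v : ρ.carrier) :
    ρ.toHom g (ρ.toHom g⁻¹ v) = v := by
  rw [← toHom_mul_apply, mul_inv_cancel, toHom_one_apply]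

/-- A subspace is invariant if it is mapped into itself by every group element. -/
def IsInvariant (ρ : UnitaryRep G) (E : Submodule ℂ ρ.carrier) : Prop :=
  ∀ g : G, ∀ v ∈ E, ρ.toHom g v ∈ E

/-- The restriction of a unitary representation to a complete invariant subspace. -/
noncomputable def restrict (ρ : UnitaryRep G) (E : Submodule ℂ ρ.carrier) [CompleteSpace E]
    (hE : ρ.IsInvariant E) : UnitaryRep G :=
  ofIsometricAction (V := E)
    { toFun := fun g => (ρ.toHom g).toLinearEquiv.toLinearMap.restrict (hE g)
      map_one' := by ext v; simp
      map_mul' := fun g h => by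
        ext v
        change ρ.toHom (g * h) v = ρ.toHom g (ρ.toHom h v)
        exact ρ.toHom_mul_apply g h v }
    (fun g v => (ρ.toHom g).norm_map v)
    (fun v => Continuous.subtype_mk (ρ.continuous_apply v) _)

theorem IsInvariant.orthogonal {ρ : UnitaryRep G} {E : Submodule ℂ ρ.carrier}
    (hE : ρ.IsInvariant E) : ρ.IsInvariant Eᗮ := by
  intro g v hv
  rw [Submodule.mem_orthogonal] at hv ⊢
  intro u hu
  have h := hv _ (hE g⁻¹ u hu)
  rwa [← (ρ.toHom g).inner_map_map, toHom_apply_inv_self] at h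

theorem IsInvariant.inf {ρ : UnitaryRep G} {E F : Submodule ℂ ρ.carrier}
    (hE : ρ.IsInvariant E) (hF : ρ.IsInvariant F) : ρ.IsInvariant (E ⊓ F) :=
  fun g v hv => ⟨hE g v hv.1, hF g v hv.2⟩

/-- Both `E` and `Eᗮ` are invariant, so the action respects the orthogonal decomposition. -/
theorem IsInvariant.starProjection_comm {ρ : UnitaryRep G} {E : Submodule ℂ ρ.carrier}
    [E.HasOrthogonalProjection] (hE : ρ.IsInvariant E) (g : G) (v : ρ.carrier) :
    E.starProjection (ρ.toHom g v) = ρ.toHom g (E.starProjection v) := by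
  refine Submodule.eq_starProjection_of_mem_orthogonal
    (hE g _ (Submodule.starProjection_apply_mem E v)) ?_
  rw [← map_sub]
  exact hE.orthogonal g _ (Submodule.sub_starProjection_mem_orthogonal v)

/-- The subspace of invariant vectors. -/
def invariants (ρ : UnitaryRep G) : Submodule ℂ ρ.carrier where
  carrier := {v | ∀ g, ρ.toHom g v = v}
  add_mem' := fun hv hw g => by rw [map_add, hv g, hw g]
  zero_mem' := fun g => map_zero _
  smul_mem' := fun c v hv g => by rw [map_smul, hv g]

theorem isInvariant_invariants (ρ : UnitaryRep G) : ρ.IsInvariant ρ.invariants := by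
  intro g v hv
  rwa [hv g]

/-! ### Almost invariant vectors and isolation of the trivial class -/

/-- A pair `(C, δ)` isolates the trivial representation if no irreducible representation without
invariant vectors has a nonzero vector that is moved by `C` by at most `δ` times its norm. -/
def IsolatesTrivial (C : Set G) (δ : ℝ) : Prop :=
  ∀ ρ : UnitaryRep G, ρ.IsIrreducible → ρ.invariants = ⊥ →
    ∀ w : ρ.carrier, (∀ x ∈ C, ‖ρ.toHom x w - w‖ ≤ δ * ‖w‖) → w = 0

theorem positiveTypeFunction_smul (ρ : UnitaryRep G) (c : ℂ) (v : ρ.carrier) (g : G) :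
    ρ.positiveTypeFunction (c • v) g = (‖c‖ ^ 2 : ℝ) * ρ.positiveTypeFunction v g := by
  simp only [positiveTypeFunction, map_smul, inner_smul_left, inner_smul_right]
  rw [← mul_assoc, mul_comm c, Complex.conj_mul']
  push_cast
  rfl

theorem exists_eq_const_of_mem_positiveCone_trivial {f : G → ℂ}
    (hf : f ∈ (trivial G).positiveCone) : ∃ c : ℝ, 0 ≤ c ∧ f = fun _ => (c : ℂ) := by
  obtain ⟨n, v, rfl⟩ := hf
  refine ⟨∑ i, ‖v i‖ ^ 2, Finset.sum_nonneg fun i _ => sq_nonneg _, ?_⟩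
  funext g
  simp only [Finset.sum_apply, positiveTypeFunction, Complex.ofReal_sum]
  refine Finset.sum_congr rfl fun i _ => ?_
  change inner ℂ (v i) (v i) = _
  rw [inner_self_eq_norm_sq_to_K]
  simp

theorem invariants_eq_top_of_equivalent_trivial {ρ : UnitaryRep G}
    (h : Equivalent ρ (trivial G)) : ρ.invariants = ⊤ := by
  obtain ⟨M, hM⟩ := h
  refine eq_top_iff.2 fun v _ g => M.injective ?_
  rw [hM]
  rfl

/-- The cone of the trivial representation consists of constants `a ≥ 0`. An almost invariant
vector, scaled to norm `√a`, has a positive type function close to `a` on `C`; this would put its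
representation in the neighbourhood that contains only `1_G`. -/
theorem exists_isolatesTrivial_of_isOpen
    (h : IsOpen ({DualObject.trivial G} : Set (DualObject G))) :
    ∃ C : Set G, IsCompact C ∧ ∃ δ : ℝ, 0 < δ ∧ IsolatesTrivial C δ := by
  obtain ⟨F, C, ε, hF, hFt, hC, hε, hW⟩ := h (DualObject.trivial G) rfl
  obtain ⟨M, hM0, hM⟩ : ∃ M : ℝ, 0 < M ∧ ∀ f ∈ F, ‖f 1‖ ≤ M := by
    obtain ⟨M, hM⟩ := (hF.image fun f => ‖f 1‖).bddAbove
    -- The maximum with 1 keeps the bound positive when all functions in `F` vanish.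
    exact ⟨max M 1, lt_max_of_lt_right one_pos,
      fun f hf => (hM ⟨f, hf, rfl⟩).trans (le_max_left _ _)⟩
  -- The approximation error is at most `a * δ` with `a ≤ M`, so this `δ` makes it at most `ε / 2`.
  refine ⟨C, hC, ε / (2 * M), by positivity, fun ρ hρ hinv w hw => ?_⟩
  by_contra hw0
  have hwn : 0 < ‖w‖ := norm_pos_iff.2 hw0
  let c : irreducibleClasses G := ⟨Quotient.mk (UnitaryRep.setoid G) ρ, ρ, hρ, rfl⟩
  have hc : c ∈ UnitaryRepClass.basicNhd (irreducibleClasses G) F C ε := by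
    intro f hf
    obtain ⟨a, ha, rfl⟩ := exists_eq_const_of_mem_positiveCone_trivial (hFt hf)
    have haM : a ≤ M := by
      have := hM _ hf
      simpa [abs_of_nonneg ha] using this
    refine ⟨ρ.positiveTypeFunction (((Real.sqrt a / ‖w‖ : ℝ) : ℂ) • w), ?_, fun x hx => ?_⟩
    · exact ⟨1, fun _ => ((Real.sqrt a / ‖w‖ : ℝ) : ℂ) • w, by simp⟩
    · rw [positiveTypeFunction_smul]
      have h1 : ‖((Real.sqrt a / ‖w‖ : ℝ) : ℂ)‖ ^ 2 = a / ‖w‖ ^ 2 := by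
        rw [Complex.norm_real, Real.norm_eq_abs, sq_abs, div_pow, Real.sq_sqrt ha]
      rw [h1]
      have h2 : (a : ℂ) - ((a / ‖w‖ ^ 2 : ℝ) : ℂ) * ρ.positiveTypeFunction w x
          = -(((a / ‖w‖ ^ 2 : ℝ) : ℂ) * inner ℂ w (ρ.toHom x w - w)) := by
        rw [inner_sub_right, inner_self_eq_norm_sq_to_K, positiveTypeFunction]
        have : (‖w‖ : ℂ) ≠ 0 := by exact_mod_cast hwn.ne'
        simp only [Complex.coe_algebraMap]
        push_cast
        field_simp
        ring
      rw [h2, norm_neg, norm_mul, Complex.norm_real, Real.norm_of_nonneg (by positivity)]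
      calc a / ‖w‖ ^ 2 * ‖inner ℂ w (ρ.toHom x w - w)‖
          ≤ a / ‖w‖ ^ 2 * (‖w‖ * (ε / (2 * M) * ‖w‖)) := by
            gcongr
            exact (norm_inner_le_norm _ _).trans (by gcongr; exact hw x hx)
        _ = ε / 2 * (a / M) := by field_simp
        _ ≤ ε / 2 * 1 := by
            gcongr
            exact (div_le_one hM0).2 haM
        _ < ε := by linarith
  have h1 : c = DualObject.trivial G := hW hc
  have h2 := invariants_eq_top_of_equivalent_trivial (Quotient.exact (congrArg Subtype.val h1))
  have : Nontrivial ρ.carrier := hρ.1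
  exact bot_ne_top (hinv.symm.trans h2)

/-- If `(C, δ)` isolates the trivial representation, then a finite-dimensional invariant subspace
without invariant vectors has no vector that is almost invariant under `C`. -/
theorem IsolatesTrivial.eq_zero_of_finrank {C : Set G} {δ : ℝ} (hδ : 0 < δ)
    (hC : IsolatesTrivial C δ) (ρ : UnitaryRep G) (E : Submodule ℂ ρ.carrier)
    [FiniteDimensional ℂ E] (hE : ρ.IsInvariant E) (hinv : ρ.invariants ⊓ E = ⊥)
    {w : ρ.carrier} (hwE : w ∈ E)
    (hw : ∀ x ∈ C, ‖ρ.toHom x w - w‖ ≤ δ / 2 ^ Module.finrank ℂ E * ‖w‖) : w = 0 := by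
  induction hd : Module.finrank ℂ E using Nat.strong_induction_on generalizing E w with
  | _ d ih =>
  subst hd
  -- Induction step: an equivariant contraction `P` does not increase displacements, and the factor
  -- 2 lost in the norm of `w` is paid for by the drop in dimension.
  have key : ∀ (P : ρ.carrier →L[ℂ] ρ.carrier) (F : Submodule ℂ ρ.carrier), F < E →
      ρ.IsInvariant F → (∀ v, ‖P v‖ ≤ ‖v‖) → (∀ g v, P (ρ.toHom g v) = ρ.toHom g (P v)) →
      P w ∈ F → ‖w‖ ≤ 2 * ‖P w‖ → w = 0 := by
    intro P F hFE hF hP hPg hPF hPw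
    have := Submodule.finiteDimensional_of_le hFE.le
    have hlt := Submodule.finrank_lt_finrank_of_lt hFE
    have h0 : P w = 0 := by
      refine ih _ hlt F hF (eq_bot_iff.2 ?_) hPF (fun x hx => ?_) rfl
      · rw [← hinv]
        exact inf_le_inf_left _ hFE.le
      · calc ‖ρ.toHom x (P w) - P w‖ = ‖P (ρ.toHom x w - w)‖ := by rw [map_sub, hPg]
          _ ≤ δ / 2 ^ Module.finrank ℂ E * ‖w‖ := (hP _).trans (hw x hx)
          _ ≤ δ / 2 ^ (Module.finrank ℂ F + 1) * (2 * ‖P w‖) := by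
              gcongr
              · norm_num
              · exact hlt
          _ = δ / 2 ^ Module.finrank ℂ F * ‖P w‖ := by
              rw [pow_succ]; field_simp
    rw [h0, norm_zero, mul_zero] at hPw
    exact norm_le_zero_iff.1 hPw
  have : CompleteSpace E := FiniteDimensional.complete ℂ E
  by_cases hirr : (ρ.restrict E hE).IsIrreducible
  · have h := hC _ hirr (eq_bot_iff.2 fun v hv => ?_) (⟨w, hwE⟩ : E) fun x hx => ?_
    · exact congrArg Subtype.val h
    · have : (v : E).1 ∈ ρ.invariants ⊓ E := ⟨fun g => congrArg Subtype.val (hv g), (v : E).2⟩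
      rw [hinv] at this
      exact Subtype.ext this
    · refine (hw x hx).trans ?_
      change _ ≤ δ * ‖w‖
      gcongr
      exact div_le_self hδ.le (one_le_pow₀ one_le_two)
  -- The zero space is not irreducible by definition, so it is treated separately.
  · by_cases hE0 : E = ⊥
    · simpa [hE0] using hwE
    have hnt : Nontrivial E := Submodule.nontrivial_iff_ne_bot.2 hE0
    obtain ⟨F', hF', hF'0, hF'1⟩ : ∃ F' : Submodule ℂ E,
        (∀ g : G, ∀ v ∈ F', (show E from (ρ.restrict E hE).toHom g v) ∈ F') ∧
          F' ≠ ⊥ ∧ F' ≠ ⊤ := by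
      by_contra! h
      exact hirr ⟨hnt, fun F' _ hF' => or_iff_not_imp_left.2 (h F' hF')⟩
    let F : Submodule ℂ ρ.carrier := F'.map E.subtype
    have hFE : F < E := by
      refine lt_of_le_of_ne (Submodule.map_subtype_le E F') fun h => hF'1 ?_
      refine eq_top_iff.2 fun v _ => ?_
      have : (v : E).1 ∈ F := h.ge (v : E).2
      obtain ⟨y, hy, hyv⟩ := this
      rwa [← Subtype.ext hyv]
    have hFinv : ρ.IsInvariant F := by
      rintro g _ ⟨y, hy, rfl⟩
      exact ⟨_, hF' g y hy, rfl⟩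
    have hF0 : F ≠ ⊥ := fun h => hF'0 <|
      Submodule.map_injective_of_injective E.injective_subtype (h.trans (Submodule.map_bot _).symm)
    have := Submodule.finiteDimensional_of_le hFE.le
    have hlt' : Fᗮ ⊓ E < E := by
      refine lt_of_le_of_ne inf_le_right fun h => hF0 ?_
      have h1 : F ≤ Fᗮ := hFE.le.trans (h ▸ inf_le_left)
      exact eq_bot_iff.2 (F.inf_orthogonal_eq_bot ▸ le_inf le_rfl h1)
    have hsum : F.starProjection w + Fᗮ.starProjection w = w :=
      Submodule.starProjection_add_starProjection_orthogonal w
    have hn := norm_add_le (F.starProjection w) (Fᗮ.starProjection w)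
    rw [hsum] at hn
    have hnorm : ∀ (K : Submodule ℂ ρ.carrier) [K.HasOrthogonalProjection] (v : ρ.carrier),
        ‖K.starProjection v‖ ≤ ‖v‖ := fun K _ v => K.norm_starProjection_apply_le v
    -- The larger of the two components of `w` has at least half its norm.
    rcases le_total ‖F.starProjection w‖ ‖Fᗮ.starProjection w‖ with h | h
    · refine key _ _ hlt' (hFinv.orthogonal.inf hE) (hnorm _)
        hFinv.orthogonal.starProjection_comm ⟨Submodule.starProjection_apply_mem _ _, ?_⟩
        (by linarith)
      rw [eq_sub_of_add_eq' hsum]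
      exact E.sub_mem hwE (hFE.le (Submodule.starProjection_apply_mem _ _))
    · exact key _ _ hFE hFinv (hnorm _) hFinv.starProjection_comm
        (Submodule.starProjection_apply_mem _ _) (by linarith)

/-- If `(C, δ)` isolates the trivial representation, then in a finite-dimensional representation
every vector that is almost invariant under `C` is close to an invariant vector. -/
theorem IsolatesTrivial.exists_mem_invariants {C : Set G} {δ : ℝ} (hδ : 0 < δ)
    (hC : IsolatesTrivial C δ) (ρ : UnitaryRep G) [FiniteDimensional ℂ ρ.carrier]
    {η : ℝ} (hη : 0 < η) {w : ρ.carrier}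
    (hw : ∀ x ∈ C, ‖ρ.toHom x w - w‖ ≤ δ / 2 ^ Module.finrank ℂ ρ.carrier * η) :
    ∃ a ∈ ρ.invariants, ‖w - a‖ ≤ η := by
  have hsum : ρ.invariants.starProjection w + ρ.invariantsᗮ.starProjection w = w :=
    Submodule.starProjection_add_starProjection_orthogonal w
  set a := ρ.invariants.starProjection w
  set b := ρ.invariantsᗮ.starProjection w
  have ha : a ∈ ρ.invariants := Submodule.starProjection_apply_mem _ _
  have hb : b ∈ ρ.invariantsᗮ := Submodule.starProjection_apply_mem _ _
  have hwb : w - a = b := (eq_sub_iff_add_eq'.2 hsum).symm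
  refine ⟨a, ha, ?_⟩
  rw [hwb]
  -- As `a` is fixed, `b` and `w` have the same displacement. If `‖b‖ > η`, the absolute bound on it
  -- becomes a bound relative to `‖b‖`.
  by_contra! hbη
  have hb0 : b = 0 := by
    refine hC.eq_zero_of_finrank hδ ρ ρ.invariantsᗮ ρ.isInvariant_invariants.orthogonal
      (Submodule.inf_orthogonal_eq_bot _) hb fun x hx => ?_
    calc ‖ρ.toHom x b - b‖ = ‖ρ.toHom x w - w‖ := by
          rw [← hwb, map_sub, ha x]; congr 1; abel
      _ ≤ δ / 2 ^ Module.finrank ℂ ρ.carrier * η := hw x hx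
      _ ≤ δ / 2 ^ Module.finrank ℂ ρ.invariantsᗮ * ‖b‖ := by
          gcongr
          · norm_num
          · exact Submodule.finrank_le _
  rw [hb0, norm_zero] at hbη
  exact hη.not_gt hbη

end UnitaryRep

/-! ### Matrix representations and intertwiners -/

open scoped Kronecker Matrix

theorem EuclideanSpace.norm_le_card_mul {κ : Type*} [Fintype κ] (v : EuclideanSpace ℂ κ) {r : ℝ}
    (hr : 0 ≤ r) (h : ∀ i, ‖v i‖ ≤ r) : ‖v‖ ≤ Fintype.card κ * r := by
  rw [EuclideanSpace.norm_eq, Real.sqrt_le_left (by positivity)]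
  calc ∑ i, ‖v i‖ ^ 2 ≤ ∑ _i : κ, r ^ 2 := by gcongr with i; exact h i
    _ = Fintype.card κ * r ^ 2 := by simp
    _ ≤ (Fintype.card κ : ℝ) ^ 2 * r ^ 2 := by
        gcongr
        exact_mod_cast Nat.le_self_pow two_ne_zero _
    _ = _ := by ring

section
attribute [local instance] Matrix.frobeniusNormedRing Matrix.frobeniusNormedAlgebra

/-- Neumann series: the Frobenius norm is submultiplicative. -/
theorem Matrix.isUnit_of_sum_norm_one_sub_lt {ι : Type*} [Fintype ι] [DecidableEq ι]
    {A : Matrix ι ι ℂ} (hA : ∑ i, ∑ j, ‖(1 - A) i j‖ ^ 2 < 1) : IsUnit A := by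
  have h : ‖1 - A‖ < 1 := by
    rw [Matrix.frobenius_norm_def]
    have h0 : 0 ≤ ∑ i, ∑ j, ‖(1 - A) i j‖ ^ (2 : ℝ) := by positivity
    refine Real.rpow_lt_one h0 ?_ (by norm_num)
    simpa using hA
  have : CompleteSpace (Matrix ι ι ℂ) := FiniteDimensional.complete ℂ _
  simpa using isUnit_one_sub_of_norm_lt_one h
end

namespace UnitaryRep

variable {G : Type u} [Group G] [TopologicalSpace G]

/-- The unitary representation on a Euclidean space given by unitary matrices. -/
noncomputable def ofUnitaryGroup {κ : Type u} [Fintype κ] [DecidableEq κ]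
    (U : G →* Matrix.unitaryGroup κ ℂ) (hU : Continuous U) : UnitaryRep G :=
  ofIsometricAction (V := EuclideanSpace ℂ κ)
    ((Matrix.toLpLinAlgEquiv 2 : Matrix κ κ ℂ ≃ₐ[ℂ] _).toAlgHom.toMonoidHom.comp
      ((Matrix.unitaryGroup κ ℂ).subtype.comp U))
    (fun g v => by
      have h : Matrix.toEuclideanCLM (𝕜 := ℂ) (U g).1 ∈
          unitary (EuclideanSpace ℂ κ →L[ℂ] EuclideanSpace ℂ κ) := Unitary.map_mem _ (U g).2
      exact ContinuousLinearMap.norm_map_of_mem_unitary h v)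
    (fun v => by
      change Continuous fun g => WithLp.toLp 2 ((U g).1 *ᵥ v.ofLp)
      have : Continuous fun g => (U g).1 := continuous_subtype_val.comp hU
      fun_prop)

theorem ofUnitaryGroup_apply {κ : Type u} [Fintype κ] [DecidableEq κ]
    (U : G →* Matrix.unitaryGroup κ ℂ) (hU : Continuous U) (g : G) (v : EuclideanSpace ℂ κ) :
    (ofUnitaryGroup U hU).toHom g v = WithLp.toLp 2 ((U g).1 *ᵥ v.ofLp) := rfl

instance {κ : Type u} [Fintype κ] [DecidableEq κ]
    (U : G →* Matrix.unitaryGroup κ ℂ) (hU : Continuous U) :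
    FiniteDimensional ℂ (ofUnitaryGroup U hU).carrier :=
  inferInstanceAs (FiniteDimensional ℂ (EuclideanSpace ℂ κ))

/-- The action `X ↦ σ(g) X π(g)⁻¹` on matrices, as a homomorphism into Kronecker products. -/
noncomputable def intertwiningAction {ι : Type*} [Fintype ι] [DecidableEq ι]
    (π σ : G →* Matrix.unitaryGroup ι ℂ) : G →* Matrix.unitaryGroup (ι × ι) ℂ where
  toFun g := ⟨(π g⁻¹).1ᵀ ⊗ₖ (σ g).1, Matrix.kronecker_mem_unitary
    (Matrix.transpose_mem_unitaryGroup_iff.2 (π g⁻¹).2) (σ g).2⟩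
  map_one' := Subtype.ext (by simp)
  map_mul' g h := Subtype.ext (by simp [Matrix.mul_kronecker_mul, Matrix.transpose_mul])

theorem continuous_intertwiningAction [IsTopologicalGroup G] {ι : Type*} [Fintype ι] [DecidableEq ι]
    {π σ : G →* Matrix.unitaryGroup ι ℂ} (hπ : Continuous π) (hσ : Continuous σ) :
    Continuous (intertwiningAction π σ) := by
  have h1 : Continuous fun g => (π g⁻¹).1 := continuous_subtype_val.comp (hπ.comp continuous_inv)
  have h2 : Continuous fun g => (σ g).1 := continuous_subtype_val.comp hσ
  refine Continuous.subtype_mk (continuous_matrix fun i j => ?_) _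
  exact (h1.matrix_elem j.1 i.1).mul (h2.matrix_elem i.2 j.2)

omit [TopologicalSpace G] in
theorem intertwiningAction_mulVec_vec {ι : Type*} [Fintype ι] [DecidableEq ι]
    (π σ : G →* Matrix.unitaryGroup ι ℂ) (g : G) (X : Matrix ι ι ℂ) :
    (intertwiningAction π σ g).1 *ᵥ X.vec = ((σ g).1 * X * (π g⁻¹).1).vec := by
  change ((π g⁻¹).1ᵀ ⊗ₖ (σ g).1) *ᵥ X.vec = _
  rw [Matrix.kronecker_mulVec_vec, Matrix.transpose_transpose]

/-- If the trivial representation is isolated by `(C, δ)`, then two representations of the same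
finite degree that are uniformly close on `C` are conjugate. -/
theorem IsolatesTrivial.exists_isUnit_intertwining [IsTopologicalGroup G] {C : Set G} {δ : ℝ}
    (hδ : 0 < δ) (hC : IsolatesTrivial C δ) (ι : Type u) [Fintype ι] [DecidableEq ι] :
    ∃ r : ℝ, 0 < r ∧ ∀ π σ : G →* Matrix.unitaryGroup ι ℂ, Continuous π → Continuous σ →
      (∀ x ∈ C, ∀ i j, ‖(σ x).1 i j - (π x).1 i j‖ ≤ r) →
      ∃ A : Matrix ι ι ℂ, IsUnit A ∧ ∀ g, (σ g).1 * A = A * (π g).1 := by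
  set d := Module.finrank ℂ (EuclideanSpace ℂ (ι × ι))
  set n := Fintype.card ι with hn
  -- Multiplying by a unitary matrix, whose entries are at most 1, costs a factor `n`; passing from
  -- `n * n` entries to the norm costs `n * n`. The `+ 1` covers `n = 0`, and any distance below 1
  -- in place of `1 / 2` would still force invertibility.
  have hr : 0 < δ / 2 ^ d * (1 / 2) / (n * n * n + 1) := by positivity
  refine ⟨_, hr, ?_⟩
  set r := δ / 2 ^ d * (1 / 2) / (n * n * n + 1)
  intro π σ hπ hσ h
  have hU := continuous_intertwiningAction hπ hσ
  set ρ := ofUnitaryGroup _ hU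
  have hmul : ∀ g, (π g).1 * (π g⁻¹).1 = 1 := fun g => by
    rw [← Submonoid.coe_mul, ← map_mul, mul_inv_cancel, map_one, Submonoid.coe_one]
  have hmul' : ∀ g, (π g⁻¹).1 * (π g).1 = 1 := fun g => by
    rw [← Submonoid.coe_mul, ← map_mul, inv_mul_cancel, map_one, Submonoid.coe_one]
  let w : ρ.carrier := (WithLp.toLp 2 (1 : Matrix ι ι ℂ).vec : EuclideanSpace ℂ (ι × ι))
  have hw : ∀ x ∈ C, ‖ρ.toHom x w - w‖ ≤ δ / 2 ^ d * (1 / 2) := by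
    intro x hx
    have h1 : ρ.toHom x w - w =
        (WithLp.toLp 2 (((σ x).1 - (π x).1) * (π x⁻¹).1).vec : EuclideanSpace ℂ (ι × ι)) := by
      rw [ofUnitaryGroup_apply, intertwiningAction_mulVec_vec, mul_one, sub_mul, hmul]
      rfl
    rw [h1]
    have h2 : ∀ i j, ‖(((σ x).1 - (π x).1) * (π x⁻¹).1) i j‖ ≤ n * r := by
      intro i j
      rw [Matrix.mul_apply]
      calc _ ≤ ∑ _k : ι, r * 1 := by
            refine norm_sum_le_of_le _ fun k _ => ?_
            rw [norm_mul]
            gcongr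
            · exact h x hx i k
            · exact entry_norm_bound_of_unitary (π x⁻¹).2 k j
        _ = n * r := by simp [hn]
    refine (EuclideanSpace.norm_le_card_mul _ (by positivity) fun i => h2 i.2 i.1).trans ?_
    rw [Fintype.card_prod, Nat.cast_mul, ← hn]
    have : (n * n * n + 1 : ℝ) * r = δ / 2 ^ d * (1 / 2) := by
      simp only [r]; field_simp
    rw [← this]
    nlinarith
  obtain ⟨a, ha, hwa⟩ := hC.exists_mem_invariants hδ ρ one_half_pos hw
  -- `Matrix.vec` stacks columns, hence the swapped indices.
  let A : Matrix ι ι ℂ := Matrix.of fun i j => (show EuclideanSpace ℂ (ι × ι) from a).ofLp (j, i)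
  refine ⟨A, Matrix.isUnit_of_sum_norm_one_sub_lt ?_, fun g => ?_⟩
  · have h1 : ‖w - a‖ ^ 2 ≤ (1 / 2) ^ 2 := pow_le_pow_left₀ (norm_nonneg _) hwa 2
    erw [EuclideanSpace.norm_sq_eq, Fintype.sum_prod_type, Finset.sum_comm] at h1
    refine lt_of_le_of_lt h1 (by norm_num)
  · have h1 : (intertwiningAction π σ g).1 *ᵥ A.vec = A.vec :=
      congrArg WithLp.ofLp (ha g)
    rw [intertwiningAction_mulVec_vec, Matrix.vec_inj] at h1
    calc (σ g).1 * A = (σ g).1 * A * ((π g⁻¹).1 * (π g).1) := by rw [hmul', mul_one]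
      _ = A * (π g).1 := by rw [← mul_assoc, h1]

end UnitaryRep

/-! ### Two metrizability criteria -/

open MeasureTheory

/-- A countable compact Hausdorff space is metrizable. -/
theorem TopologicalSpace.MetrizableSpace.of_countable_of_compactSpace (X : Type*)
    [TopologicalSpace X] [CompactSpace X] [T2Space X] [Countable X] :
    TopologicalSpace.MetrizableSpace X := by
  cases isEmpty_or_nonempty {p : X × X // p.1 ≠ p.2} with
  | inl h =>
    have : Subsingleton X := ⟨fun x y => by_contra fun hxy => h.false ⟨(x, y), hxy⟩⟩
    infer_instance
  | inr h =>
    -- One Urysohn function per pair of distinct points gives a countable separating family.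
    have key : ∀ p : {p : X × X // p.1 ≠ p.2}, ∃ f : C(X, ℝ), f p.1.1 ≠ f p.1.2 := by
      rintro ⟨⟨x, y⟩, hxy⟩
      obtain ⟨f, hf0, hf1, -⟩ := exists_continuous_zero_one_of_isClosed
        (isClosed_singleton (x := x)) (isClosed_singleton (x := y)) (by simpa using hxy)
      refine ⟨f, ?_⟩
      change f x ≠ f y
      rw [hf0 rfl, hf1 rfl]
      simp
    choose f hf using key
    obtain ⟨e, he⟩ := exists_surjective_nat {p : X × X // p.1 ≠ p.2}
    refine Metric.PiNatEmbed.TopologicalSpace.MetrizableSpace.of_countable_separating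
      (fun n => f (e n)) (fun n => (f (e n)).continuous) ?_
    intro x y hxy
    obtain ⟨n, hn⟩ := he ⟨(x, y), hxy⟩
    exact ⟨n, by simpa [hn] using hf ⟨(x, y), hxy⟩⟩

/-- A Hausdorff topological group with a dense metrizable subgroup is metrizable. -/
theorem Subgroup.metrizableSpace_of_dense {H : Type*} [Group H] [TopologicalSpace H]
    [IsTopologicalGroup H] [T2Space H] (G : Subgroup H) (hG : Dense (G : Set H))
    [TopologicalSpace.MetrizableSpace G] : TopologicalSpace.MetrizableSpace H := by
  have hd : IsDenseInducing (Subtype.val : G → H) := hG.isDenseInducing_val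
  -- H is regular, so the closures in H of a countable base at 1 in G form a base at 1 in H; a
  -- countable base at 1 makes the group uniformity countably generated.
  obtain ⟨s, hs⟩ := (nhds (1 : G)).exists_antitone_basis
  have h1 : (nhds ((1 : G) : H)).IsCountablyGenerated :=
    (hs.1.hasBasis_of_isDenseInducing hd).isCountablyGenerated
  let := IsTopologicalGroup.rightUniformSpace H
  have h2 : (uniformity H).IsCountablyGenerated := by
    rw [uniformity_eq_comap_nhds_one']
    exact Filter.comap.isCountablyGenerated _ _
  exact UniformSpace.metrizableSpace

/-! ### Averaging over a compact group and finite-dimensional invariant subspaces -/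

namespace UnitaryRep

open ContinuousLinearMap InnerProductSpace

section averaging

variable {K : Type u} [Group K] [TopologicalSpace K] [IsTopologicalGroup K] [CompactSpace K]
  [MeasurableSpace K] [BorelSpace K]

omit [IsTopologicalGroup K] [CompactSpace K] [MeasurableSpace K] [BorelSpace K] in
theorem continuous_rankOne_orbit (ρ : UnitaryRep K) (v : ρ.carrier) :
    Continuous fun g => rankOne ℂ (ρ.toHom g v) (ρ.toHom g v) := by
  have h := ρ.continuous_apply v
  have h' : Continuous fun g => smulRightL ℂ ρ.carrier ρ.carrier (innerSL ℂ (ρ.toHom g v)) :=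
    (smulRightL ℂ ρ.carrier ρ.carrier).continuous.comp ((innerSL ℂ).continuous.comp h)
  exact h'.clm_apply h

omit [IsTopologicalGroup K] in
theorem integrable_rankOne_orbit (ρ : UnitaryRep K) (v : ρ.carrier) (μ : Measure K)
    [IsFiniteMeasureOnCompacts μ] :
    Integrable (fun g => rankOne ℂ (ρ.toHom g v) (ρ.toHom g v)) μ :=
  (ρ.continuous_rankOne_orbit v).integrable_of_hasCompactSupport (.of_compactSpace _)

/-- The average of the rank-one operators attached to the orbit of a vector. -/
noncomputable def average (ρ : UnitaryRep K) (μ : Measure K) (v : ρ.carrier) :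
    ρ.carrier →L[ℂ] ρ.carrier :=
  ∫ g, rankOne ℂ (ρ.toHom g v) (ρ.toHom g v) ∂μ

omit [IsTopologicalGroup K] in
theorem average_apply (ρ : UnitaryRep K) (μ : Measure K) [IsFiniteMeasureOnCompacts μ]
    (v y : ρ.carrier) :
    ρ.average μ v y = ∫ g, inner ℂ (ρ.toHom g v) y • ρ.toHom g v ∂μ := by
  rw [average, ContinuousLinearMap.integral_apply (ρ.integrable_rankOne_orbit v μ)]
  rfl

-- Compact operators form a closed convex set, and the average is taken over rank-one operators
-- against a probability measure.
omit [IsTopologicalGroup K] in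
theorem isCompactOperator_average (ρ : UnitaryRep K) (μ : Measure K) [IsProbabilityMeasure μ]
    (v : ρ.carrier) : IsCompactOperator (ρ.average μ v) := by
  have hc : Convex ℝ {f : ρ.carrier →L[ℂ] ρ.carrier | IsCompactOperator f} :=
    ((compactOperator (RingHom.id ℂ) ρ.carrier ρ.carrier).restrictScalars ℝ).convex
  refine hc.integral_mem isClosed_setOfPred_isCompactOperator (.of_forall fun g => ?_)
    (ρ.integrable_rankOne_orbit v μ)
  change IsCompactOperator (rankOne ℂ (ρ.toHom g v) (ρ.toHom g v))
  have h : IsCompactOperator (innerSL ℂ (ρ.toHom g v) : ρ.carrier →L[ℂ] ℂ) :=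
    isCompactOperator_of_locallyCompactSpace_dom _
  exact h.clm_comp (ContinuousLinearMap.toSpanSingleton ℂ (ρ.toHom g v))

omit [IsTopologicalGroup K] in
theorem isSymmetric_average (ρ : UnitaryRep K) (μ : Measure K) [IsFiniteMeasureOnCompacts μ]
    (v : ρ.carrier) : (ρ.average μ v).IsSymmetric := by
  have hint : ∀ y, Integrable (fun g => inner ℂ (ρ.toHom g v) y • ρ.toHom g v) μ := fun y =>
    (ρ.integrable_rankOne_orbit v μ).apply_continuousLinearMap y
  intro y z
  change inner ℂ (ρ.average μ v y) z = inner ℂ y (ρ.average μ v z)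
  rw [average_apply, average_apply, ← integral_inner (hint z), ← inner_conj_symm,
    ← integral_inner (hint y), ← integral_conj]
  congr 1
  funext g
  simp only [inner_smul_right, map_mul, inner_conj_symm]
  ring

theorem average_comm (ρ : UnitaryRep K) (μ : Measure K) [IsFiniteMeasureOnCompacts μ]
    [μ.IsMulLeftInvariant] (v y : ρ.carrier) (h : K) :
    ρ.average μ v (ρ.toHom h y) = ρ.toHom h (ρ.average μ v y) := by
  rw [average_apply, average_apply, ← integral_mul_left_eq_self _ h]
  have h1 := (ρ.toHom h).toContinuousLinearEquiv.integral_comp_comm (μ := μ)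
    (fun g => inner ℂ (ρ.toHom g v) y • ρ.toHom g v)
  refine Eq.trans ?_ h1
  congr 1
  funext g
  simp

-- Pairing the average at `v` with `v` gives the integral of `|(gv, v)|²`, a continuous function
-- that is positive at `g = 1`.
omit [IsTopologicalGroup K] in
theorem average_ne_zero (ρ : UnitaryRep K) (μ : Measure K) [IsFiniteMeasureOnCompacts μ]
    [μ.IsOpenPosMeasure] {v : ρ.carrier} (hv : v ≠ 0) : ρ.average μ v ≠ 0 := by
  have hint : Integrable (fun g => inner ℂ (ρ.toHom g v) v • ρ.toHom g v) μ :=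
    (ρ.integrable_rankOne_orbit v μ).apply_continuousLinearMap v
  intro h0
  have h1 : inner ℂ v (ρ.average μ v v) = 0 := by rw [h0]; simp
  have hc := ρ.continuous_apply v
  have h2 : ∫ g, ‖(inner ℂ (ρ.toHom g v) v : ℂ)‖ ^ 2 ∂μ = 0 := by
    rw [average_apply, ← integral_inner hint] at h1
    rw [← Complex.ofReal_eq_zero, ← integral_complex_ofReal, ← h1]
    congr 1
    funext g
    rw [inner_smul_right, ← inner_conj_symm v, Complex.mul_conj']
    push_cast
    rfl
  refine (Continuous.integral_pos_of_hasCompactSupport_nonneg_nonzero (x := (1 : K))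
    (f := fun g => ‖(inner ℂ (ρ.toHom g v) v : ℂ)‖ ^ 2) (by fun_prop) (.of_compactSpace _)
    (fun g => sq_nonneg _) ?_).ne' h2
  simpa [toHom_one_apply] using hv

end averaging

section compact

variable {K : Type u} [Group K] [TopologicalSpace K] [IsTopologicalGroup K] [CompactSpace K]

/-- Every nonzero unitary representation of a compact group has a nonzero finite-dimensional
invariant subspace. -/
theorem exists_finiteDimensional_isInvariant (ρ : UnitaryRep K) [Nontrivial ρ.carrier] :
    ∃ E : Submodule ℂ ρ.carrier, E ≠ ⊥ ∧ FiniteDimensional ℂ E ∧ ρ.IsInvariant E := by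
  borelize K
  let μ : Measure K := Measure.haarMeasure ⊤
  have : IsProbabilityMeasure μ :=
    ⟨Measure.haarMeasure_self (K₀ := (⊤ : TopologicalSpace.PositiveCompacts K))⟩
  obtain ⟨v, hv⟩ := exists_ne (0 : ρ.carrier)
  have hcomp := ρ.isCompactOperator_average μ v
  -- Spectral theorem: a nonzero compact symmetric operator has a nonzero eigenvalue. Its eigenspace
  -- is finite-dimensional, and invariant because the average commutes with the action.
  have h := mt (ContinuousLinearMap.eq_zero_of_forall_hasEigenvalue_eq_zero hcomp
    (ρ.isSymmetric_average μ v)).1 (ρ.average_ne_zero μ hv)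
  push Not at h
  obtain ⟨c, hc, hc0⟩ := h
  refine ⟨_, hc, ContinuousLinearMap.finite_dimensional_eigenspace hcomp c hc0, fun g u hu => ?_⟩
  rw [Module.End.mem_eigenspace_iff] at hu ⊢
  change ρ.average μ v u = c • u at hu
  change ρ.average μ v (ρ.toHom g u) = c • ρ.toHom g u
  rw [average_comm, hu, map_smul]

/-- A group element that acts nontrivially in a unitary representation of a compact group acts
nontrivially on a finite-dimensional invariant subspace. -/
theorem exists_finiteDimensional_isInvariant_ne (ρ : UnitaryRep K) {x : K} {v : ρ.carrier}
    (hv : ρ.toHom x v ≠ v) : ∃ E : Submodule ℂ ρ.carrier, FiniteDimensional ℂ E ∧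
      ρ.IsInvariant E ∧ ∃ u ∈ E, ρ.toHom x u ≠ u := by
  by_contra! hfix
  -- If `x` fixes every finite-dimensional invariant subspace, it fixes the closure of their sum
  -- `S`, which therefore misses `v`. Then `Sᗮ` is nonzero and contains another such subspace, which
  -- must lie in `S` as well.
  let S : Submodule ℂ ρ.carrier :=
    ⨆ E : {E : Submodule ℂ ρ.carrier // FiniteDimensional ℂ E ∧ ρ.IsInvariant E}, E.1
  let F : Submodule ℂ ρ.carrier := LinearMap.eqLocus (ρ.toHom x).toLinearEquiv.toLinearMap LinearMap.id
  have hF : IsClosed (F : Set ρ.carrier) :=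
    isClosed_eq (ρ.toHom x).continuous continuous_id
  have hSF : S ≤ F := iSup_le fun E u hu => hfix E.1 E.2.1 E.2.2 u hu
  have hSinv : ρ.IsInvariant S := by
    intro g
    change S ≤ S.comap (ρ.toHom g).toLinearEquiv.toLinearMap
    refine iSup_le fun E u hu => ?_
    exact le_iSup (fun E : {E : Submodule ℂ ρ.carrier //
      FiniteDimensional ℂ E ∧ ρ.IsInvariant E} => E.1) E (E.2.2 g u hu)
  have hS : Sᗮ ≠ ⊥ := by
    intro h
    rw [← Submodule.topologicalClosure_eq_top_iff] at h
    have : v ∈ F := S.topologicalClosure_minimal hSF hF (h ▸ Submodule.mem_top)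
    exact hv this
  let τ := ρ.restrict Sᗮ hSinv.orthogonal
  have : Nontrivial τ.carrier := Submodule.nontrivial_iff_ne_bot.2 hS
  obtain ⟨E, hE0, hEfin, hE⟩ : ∃ E : Submodule ℂ Sᗮ, E ≠ ⊥ ∧ FiniteDimensional ℂ E ∧
      ∀ g, ∀ y ∈ E, (show Sᗮ from τ.toHom g y) ∈ E :=
    τ.exists_finiteDimensional_isInvariant
  have hE' : E.map Sᗮ.subtype ≤ S := by
    refine le_iSup (fun E : {E : Submodule ℂ ρ.carrier //
      FiniteDimensional ℂ E ∧ ρ.IsInvariant E} => E.1) ⟨E.map Sᗮ.subtype, ?_, ?_⟩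
    · infer_instance
    · rintro g _ ⟨y, hy, rfl⟩
      exact ⟨_, hE g y hy, rfl⟩
  refine hE0 (Submodule.map_injective_of_injective Sᗮ.injective_subtype ?_)
  rw [Submodule.map_bot, eq_bot_iff, ← S.inf_orthogonal_eq_bot]
  exact le_inf hE' (Submodule.map_subtype_le _ _)

end compact

/-! ### Representations in matrix form -/

section matrix

variable {G : Type u} [Group G] [TopologicalSpace G]

/-- The unitary matrices of a representation in an orthonormal basis. -/
noncomputable def toUnitaryGroup (ρ : UnitaryRep G) [FiniteDimensional ℂ ρ.carrier]
    {ι : Type*} [Fintype ι] [DecidableEq ι]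
    (b : OrthonormalBasis ι ℂ ρ.carrier) : G →* Matrix.unitaryGroup ι ℂ where
  toFun g := ⟨LinearMap.toMatrixOrthonormal b (ρ.toHom g).toLinearEquiv.toLinearMap, by
    have key : star (LinearMap.toMatrixOrthonormal b (ρ.toHom g).toLinearEquiv.toLinearMap) =
        LinearMap.toMatrixOrthonormal b (ρ.toHom g⁻¹).toLinearEquiv.toLinearMap := by
      ext i j
      rw [Matrix.star_apply, LinearMap.toMatrixOrthonormal_apply_apply,
        LinearMap.toMatrixOrthonormal_apply_apply, RCLike.star_def, inner_conj_symm]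
      change inner ℂ (ρ.toHom g (b i)) (b j) = inner ℂ (b i) (ρ.toHom g⁻¹ (b j))
      rw [← (ρ.toHom g).inner_map_map (b i), toHom_apply_inv_self]
    rw [Matrix.mem_unitaryGroup_iff', key, ← map_mul, ← map_one (LinearMap.toMatrixOrthonormal b)]
    congr 1
    ext v
    exact ρ.toHom_inv_apply_self g v⟩
  map_one' := by
    refine Subtype.ext ?_
    change LinearMap.toMatrixOrthonormal b _ = 1
    rw [← map_one (LinearMap.toMatrixOrthonormal b)]
    congr 1
    ext v
    exact ρ.toHom_one_apply v
  map_mul' g h := by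
    refine Subtype.ext ?_
    change LinearMap.toMatrixOrthonormal b _ =
      LinearMap.toMatrixOrthonormal b _ * LinearMap.toMatrixOrthonormal b _
    rw [← map_mul]
    congr 1
    ext v
    exact ρ.toHom_mul_apply g h v

theorem toUnitaryGroup_apply (ρ : UnitaryRep G) [FiniteDimensional ℂ ρ.carrier]
    {ι : Type*} [Fintype ι] [DecidableEq ι]
    (b : OrthonormalBasis ι ℂ ρ.carrier) (g : G) (i j : ι) :
    (ρ.toUnitaryGroup b g).1 i j = inner ℂ (b i) (ρ.toHom g (b j)) :=
  LinearMap.toMatrixOrthonormal_apply_apply _ _ _ _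

theorem continuous_toUnitaryGroup (ρ : UnitaryRep G) [FiniteDimensional ℂ ρ.carrier]
    {ι : Type*} [Fintype ι] [DecidableEq ι]
    (b : OrthonormalBasis ι ℂ ρ.carrier) : Continuous (ρ.toUnitaryGroup b) := by
  refine continuous_induced_rng.2 (continuous_matrix fun i j => ?_)
  have h := ρ.continuous_apply (b j)
  simp only [Function.comp_apply, toUnitaryGroup_apply]
  fun_prop

theorem toHom_apply_eq_of_toUnitaryGroup_eq_one (ρ : UnitaryRep G)
    [FiniteDimensional ℂ ρ.carrier] {ι : Type*} [Fintype ι]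
    [DecidableEq ι] (b : OrthonormalBasis ι ℂ ρ.carrier) {g : G}
    (h : ρ.toUnitaryGroup b g = 1) (v : ρ.carrier) : ρ.toHom g v = v := by
  have h1 : LinearMap.toMatrixOrthonormal b (ρ.toHom g).toLinearEquiv.toLinearMap = 1 :=
    congrArg Subtype.val h
  rw [← map_one (LinearMap.toMatrixOrthonormal b)] at h1
  exact LinearMap.congr_fun ((LinearMap.toMatrixOrthonormal b).injective h1) v

end matrix

/-! ### The regular representation and separation of points -/

section regular

variable (K : Type u) [Group K] [TopologicalSpace K] [IsTopologicalGroup K] [CompactSpace K]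
  [T2Space K]

/-- The left regular representation of a compact group. -/
noncomputable def regular [MeasurableSpace K] [BorelSpace K] : UnitaryRep K :=
  haveI : Fact ((2 : ENNReal) ≠ ⊤) := ⟨by simp⟩
  ofIsometricAction (V := Lp ℂ 2 (Measure.haar : Measure K))
    { toFun := fun g =>
        -- `DomMulAct` reverses products; the inverse restores their order.
        { toFun := fun f => DomMulAct.mk g⁻¹ • f
          map_add' := fun f f' => smul_add _ f f'
          map_smul' := fun c f => smul_comm _ _ _ }
      map_one' := by ext1 f; simp
      map_mul' := fun g h => by
        ext1 f
        change DomMulAct.mk (g * h)⁻¹ • f = DomMulAct.mk g⁻¹ • DomMulAct.mk h⁻¹ • f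
        rw [smul_smul, mul_inv_rev]
        rfl }
    (fun g f => DomMulAct.norm_smul_Lp _ _)
    (fun f => by
      change Continuous fun g : K => DomMulAct.mk g⁻¹ • f
      have : Continuous fun g : K => DomMulAct.mk g⁻¹ := DomMulAct.continuous_mk.comp continuous_inv
      fun_prop)

/-- Translation by `x` moves a Urysohn function separating `x⁻¹` from 1. Haar measure charges open
sets, so continuous functions with the same class in L² agree everywhere. -/
theorem exists_regular_apply_ne [MeasurableSpace K] [BorelSpace K] {x : K} (hx : x ≠ 1) :
    ∃ v, (regular K).toHom x v ≠ v := by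
  obtain ⟨f, hf0, hf1, -⟩ := exists_continuous_zero_one_of_isClosed
    (isClosed_singleton (x := x⁻¹)) (isClosed_singleton (x := (1 : K))) (by simpa using hx)
  let F : C(K, ℂ) := ⟨fun y => (f y : ℂ), by fun_prop⟩
  have hF : MemLp F 2 (Measure.haar : Measure K) :=
    F.continuous.memLp_of_hasCompactSupport (.of_compactSpace _)
  refine ⟨hF.toLp F, fun h => ?_⟩
  have h1 := (DomMulAct.mk_smul_toLp (μ := (Measure.haar : Measure K)) x⁻¹ hF).symm.trans h
  rw [MemLp.toLp_eq_toLp_iff] at h1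
  have h2 := Continuous.ae_eq_iff_eq (μ := (Measure.haar : Measure K))
    (F.continuous.comp (continuous_const_smul x⁻¹)) F.continuous |>.1 h1
  have h3 : F (x⁻¹ • 1) = F 1 := congrFun h2 1
  simp only [smul_eq_mul, mul_one] at h3
  change ((f x⁻¹ : ℝ) : ℂ) = (f 1 : ℝ) at h3
  rw [hf0 rfl, hf1 rfl] at h3
  simp at h3

variable {K} in
/-- The continuous finite-dimensional unitary representations of a compact group separate points
(a weak form of the Peter–Weyl theorem). -/
theorem exists_unitaryGroup_ne_one {x : K} (hx : x ≠ 1) :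
    ∃ (n : ℕ) (π : K →* Matrix.unitaryGroup (ULift.{u} (Fin n)) ℂ), Continuous π ∧ π x ≠ 1 := by
  borelize K
  obtain ⟨v, hv⟩ := exists_regular_apply_ne K hx
  obtain ⟨E, hEfin, hE, u, hu, hxu⟩ := exists_finiteDimensional_isInvariant_ne _ hv
  have : CompleteSpace E := FiniteDimensional.complete ℂ E
  let ρ := (regular K).restrict E hE
  have : FiniteDimensional ℂ ρ.carrier := hEfin
  -- `ULift` puts the index type in the universe that `ofUnitaryGroup` requires.
  let b := (stdOrthonormalBasis ℂ ρ.carrier).reindex Equiv.ulift.{u}.symm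
  refine ⟨_, ρ.toUnitaryGroup b, ρ.continuous_toUnitaryGroup b, fun h => hxu ?_⟩
  exact congrArg Subtype.val (ρ.toHom_apply_eq_of_toUnitaryGroup_eq_one b h ⟨u, hu⟩)

end regular

end UnitaryRep

/-! ### Countably many representations and metrizability -/

namespace UnitaryRep

variable {G : Type u} [Group G] [TopologicalSpace G]

/-- If the trivial representation is isolated, then in each degree countably many representations
suffice up to conjugation. -/
theorem IsolatesTrivial.exists_countable_intertwining [IsTopologicalGroup G] [Countable G]
    [T2Space G] {C : Set G} (hCc : IsCompact C) {δ : ℝ} (hδ : 0 < δ) (hC : IsolatesTrivial C δ)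
    (ι : Type u) [Fintype ι] [DecidableEq ι] :
    ∃ D : Set (G →* Matrix.unitaryGroup ι ℂ), D.Countable ∧ (∀ σ ∈ D, Continuous σ) ∧
      ∀ π : G →* Matrix.unitaryGroup ι ℂ, Continuous π →
        ∃ σ ∈ D, ∃ A : Matrix ι ι ℂ, IsUnit A ∧ ∀ g, (σ g).1 * A = A * (π g).1 := by
  obtain ⟨r, hr, h⟩ := hC.exists_isUnit_intertwining hδ ι
  have : CompactSpace C := isCompact_iff_compactSpace.1 hCc
  have : TopologicalSpace.MetrizableSpace C := .of_countable_of_compactSpace C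
  let S := {π : G →* Matrix.unitaryGroup ι ℂ // Continuous π}
  have hcont : ∀ π : S, Continuous fun x : C => ((π.1 x.1).1 : ι → ι → ℂ) := by
    intro π
    have h1 : Continuous fun x : C => π.1 x.1 := π.2.comp continuous_subtype_val
    exact continuous_subtype_val.comp h1
  let f : S → C(C, ι → ι → ℂ) := fun π => ⟨fun x => (π.1 x.1).1, hcont π⟩
  -- Restriction to `C` need not be injective; only closeness on `C` matters for `h`.
  let := TopologicalSpace.induced f inferInstance
  have : SecondCountableTopology S := TopologicalSpace.secondCountableTopology_induced S _ f
  obtain ⟨t, htc, htd⟩ := TopologicalSpace.exists_countable_dense S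
  refine ⟨Subtype.val '' t, htc.image _, ?_, fun π hπ => ?_⟩
  · rintro _ ⟨σ, -, rfl⟩
    exact σ.2
  · have hopen : IsOpen (f ⁻¹' Metric.ball (f ⟨π, hπ⟩) r) :=
      Metric.isOpen_ball.preimage continuous_induced_dom
    obtain ⟨σ, hσ, hσt⟩ := htd.exists_mem_open hopen ⟨⟨π, hπ⟩, by simpa using hr⟩
    refine ⟨σ.1, ⟨σ, hσ, rfl⟩, h π σ.1 hπ σ.2 fun x hx i j => ?_⟩
    have h1 : dist (f σ) (f ⟨π, hπ⟩) < r := hσt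
    have h2 := (ContinuousMap.dist_apply_le_dist (f := f σ) (g := f ⟨π, hπ⟩) ⟨x, hx⟩).trans h1.le
    rw [dist_pi_le_iff hr.le] at h2
    have h3 := (dist_pi_le_iff hr.le).1 (h2 i) j
    rwa [dist_eq_norm] at h3

/-- The topology of a precompact group is induced by its continuous finite-dimensional unitary
representations. -/
theorem isInducing_unitaryGroup (hG : IsPrecompactGroup G) :
    Topology.IsInducing fun (g : G) (i : Σ n : ℕ,
      {π : G →* Matrix.unitaryGroup (ULift.{u} (Fin n)) ℂ // Continuous π}) => (i.2.1 g).1 := by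
  obtain ⟨K, _, _, _, _, _, φ, hφ⟩ := hG
  let Ψ : K → ∀ i : Σ n : ℕ, {π : K →* Matrix.unitaryGroup (ULift.{u} (Fin n)) ℂ // Continuous π},
      Matrix (ULift.{u} (Fin i.1)) (ULift.{u} (Fin i.1)) ℂ := fun x i => (i.2.1 x).1
  have hΨ : Continuous Ψ := continuous_pi fun i => continuous_subtype_val.comp i.2.2
  have hinj : Function.Injective Ψ := by
    intro x y hxy
    by_contra hne
    obtain ⟨n, π, hπ, h⟩ := exists_unitaryGroup_ne_one (x := x * y⁻¹)
      (by rwa [Ne, mul_inv_eq_one])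
    apply h
    rw [map_mul, map_inv, mul_inv_eq_one]
    exact Subtype.ext (congrFun hxy ⟨n, π, hπ⟩)
  have hΨφ := (hΨ.isClosedEmbedding hinj).isInducing.comp hφ.isInducing
  -- The representations extending to `K` already induce the topology, and the remaining continuous
  -- ones cannot refine it.
  let pullback : (∀ i : Σ n : ℕ, {π : G →* Matrix.unitaryGroup (ULift.{u} (Fin n)) ℂ //
        Continuous π}, Matrix (ULift.{u} (Fin i.1)) (ULift.{u} (Fin i.1)) ℂ) →
      ∀ i : Σ n : ℕ, {π : K →* Matrix.unitaryGroup (ULift.{u} (Fin n)) ℂ // Continuous π},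
        Matrix (ULift.{u} (Fin i.1)) (ULift.{u} (Fin i.1)) ℂ :=
    fun z i => z ⟨i.1, i.2.1.comp φ, i.2.2.comp hφ.continuous⟩
  exact .of_comp (g := pullback) (continuous_pi fun i => continuous_subtype_val.comp i.2.2)
    (continuous_pi fun i => _root_.continuous_apply _) hΨφ

/-- Every π is recovered as `A⁻¹ σ A` from a σ in the countable family, so that family alone induces
the topology and embeds G in a countable product of second-countable regular spaces. -/
theorem IsolatesTrivial.metrizableSpace [IsTopologicalGroup G] [Countable G]
    (hG : IsPrecompactGroup G) {C : Set G} (hCc : IsCompact C) {δ : ℝ} (hδ : 0 < δ)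
    (hC : IsolatesTrivial C δ) : TopologicalSpace.MetrizableSpace G := by
  have : T2Space G := by
    obtain ⟨K, _, _, _, _, _, φ, hφ⟩ := hG
    exact hφ.t2Space
  choose D hDc hD h using fun n : ℕ =>
    hC.exists_countable_intertwining hCc hδ (ULift.{u} (Fin n))
  have := fun n => (hDc n).to_subtype
  choose σ hσ A hA hAσ using h
  let F : G → ∀ i : Σ n, D n, Matrix (ULift.{u} (Fin i.1)) (ULift.{u} (Fin i.1)) ℂ :=
    fun g i => (i.2.1 g).1
  have hF : Continuous F := continuous_pi fun i => continuous_subtype_val.comp (hD i.1 i.2.1 i.2.2)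
  let conj : (∀ i : Σ n, D n, Matrix (ULift.{u} (Fin i.1)) (ULift.{u} (Fin i.1)) ℂ) →
      ∀ i : Σ n : ℕ, {π : G →* Matrix.unitaryGroup (ULift.{u} (Fin n)) ℂ // Continuous π},
        Matrix (ULift.{u} (Fin i.1)) (ULift.{u} (Fin i.1)) ℂ := fun z i =>
    (A i.1 i.2.1 i.2.2)⁻¹ * (z ⟨i.1, σ i.1 i.2.1 i.2.2, hσ i.1 i.2.1 i.2.2⟩ * A i.1 i.2.1 i.2.2)
  have hconj : Continuous conj := by
    refine continuous_pi fun i => ?_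
    exact continuous_const.matrix_mul ((_root_.continuous_apply _).matrix_mul continuous_const)
  have hcomp : conj ∘ F = fun (g : G) (i : Σ n : ℕ,
      {π : G →* Matrix.unitaryGroup (ULift.{u} (Fin n)) ℂ // Continuous π}) => (i.2.1 g).1 := by
    funext g i
    change (A i.1 i.2.1 i.2.2)⁻¹ * ((σ i.1 i.2.1 i.2.2 g).1 * A i.1 i.2.1 i.2.2) = _
    rw [hAσ, ← mul_assoc,
      Matrix.nonsing_inv_mul _ ((Matrix.isUnit_iff_isUnit_det _).1 (hA i.1 i.2.1 i.2.2)), one_mul]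
  have hind : Topology.IsInducing F := .of_comp hF hconj (hcomp ▸ isInducing_unitaryGroup hG)
  have (i : Σ n, D n) :
      SecondCountableTopology (Matrix (ULift.{u} (Fin i.1)) (ULift.{u} (Fin i.1)) ℂ) :=
    inferInstanceAs (SecondCountableTopology (_ → _ → ℂ))
  have (i : Σ n, D n) : T3Space (Matrix (ULift.{u} (Fin i.1)) (ULift.{u} (Fin i.1)) ℂ) :=
    inferInstanceAs (T3Space (_ → _ → ℂ))
  exact hind.isEmbedding.metrizableSpace

end UnitaryRep

theorem theorem2 :
    (∀ (G : Type u) [Group G] [TopologicalSpace G] [IsTopologicalGroup G],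
      Countable G → IsPrecompactGroup G → ¬ TopologicalSpace.MetrizableSpace G →
        ¬ IsOpen ({DualObject.trivial G} : Set (DualObject G))) ∧
    (∀ (H : Type u) [Group H] [TopologicalSpace H] [IsTopologicalGroup H] [CompactSpace H]
      [T2Space H] (G : Subgroup H),
      ¬ TopologicalSpace.MetrizableSpace H → Countable G → Dense (G : Set H) →
        ¬ Determines G) := by
  have key : ∀ (G : Type u) [Group G] [TopologicalSpace G] [IsTopologicalGroup G],
      Countable G → IsPrecompactGroup G → ¬ TopologicalSpace.MetrizableSpace G →
        ¬ IsOpen ({DualObject.trivial G} : Set (DualObject G)) := by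
    intro G _ _ _ _ hG hm hopen
    obtain ⟨C, hCc, δ, hδ, hC⟩ := UnitaryRep.exists_isolatesTrivial_of_isOpen hopen
    exact hm (hC.metrizableSpace hG hCc hδ)
  refine ⟨key, fun H _ _ _ _ _ G hm hcount hdense hdet => ?_⟩
  refine key G hcount ⟨H, _, _, inferInstance, inferInstance, inferInstance, G.subtype,
    Topology.IsEmbedding.subtypeVal⟩ (fun _ => hm (G.metrizableSpace_of_dense hdense)) ?_
  have : DiscreteTopology (DualObject G) := hdet
  exact isOpen_discrete _
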